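/- A function $f:\{0,1\}^n\to\{0,1\}$ is $k$-monotone if there is no chain $x_1\prec x_2\prec\dots\prec x_{k+1}$ in $\{0,1\}^n$ (coordinatewise order) with $f(x_1)=1$ and $f(x_i)\neq f(x_{i+1})$ for all $1\le i\le k$; let $\mathcal M_k$ be the set of $k$-monotone functions. Let $d(f,g)=2^{-n}\,|\{x: f(x)\ne g(x)\}|$ and $d(f,\mathcal M_k)=\min_{g\in\mathcal M_k} d(f,g)$. A non-adaptive, one-sided $q$-query tester for $k$-monotonicity with proximity parameter $\varepsilon\in(0,1]$ is a randomized algorithm that chooses a set of at most $q$ points of $\{0,1\}^n$ depending only on its internal randomness, reads the values of an unknown $f$ at these points, and then accepts or rejects (depending only on its randomness and these values), such that every $f\in\mathcal M_k$ is accepted with probability $1$ and every $f$ with $d(f,\mathcal M_k)\ge\varepsilon$ is rejected with probability at least $2/3$. **Theorem.** Any non-adaptive, one-sided tester for $k$-monotonicity, for $2\le k=o(\sqrt n)$, requires $\Omega(\exp(\sqrt[4]{n}))$ queries. Precisely: there are absolute constants $\varepsilon_0\in(0,1]$ and $c>0$ such that for every function $k:\mathbb N\to\mathbb N$ with $k(n)\ge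 2$ for all $n$ and $k(n)=o(\sqrt n)$ there is $n_0$ such that for all $n\ge n_0$ and all $0<\varepsilon\le\varepsilon_0$, every non-adaptive, one-sided $q$-query tester for $k(n)$-monotonicity of functions $\{0,1\}^n\to\{0,1\}$ with proximity parameter $\varepsilon$ satisfies $q\ge c\cdot\exp(n^{1/4})$. -/

import Mathlib

namespace KMonotoneTesting

/-- The Boolean hypercube `{0,1}^n`, with its coordinatewise order (`false < true`). -/
abbrev Cube (n : ℕ) : Type := Fin n → Bool

/-- A violation of `k`-monotonicity for `f`: a chain `x 0 ≺ x 1 ≺ ⋯ ≺ x k` of `k + 1` points such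
that `f (x 0) = 1` and `f` changes value at each of the `k` steps of the chain. -/
def IsViolation {n : ℕ} (k : ℕ) (f : Cube n → Bool) (x : Fin (k + 1) → Cube n) : Prop :=
  StrictMono x ∧ f (x 0) = true ∧ ∀ i : Fin k, f (x i.castSucc) ≠ f (x i.succ)

/-- The property of being `k`-monotone: no violation exists. -/
def kMonotone (n k : ℕ) : Set (Cube n → Bool) :=
  {f | ¬ ∃ x : Fin (k + 1) → Cube n, IsViolation k f x}

/-- Normalized Hamming distance between two Boolean functions on the cube. -/
noncomputable def funDist {n : ℕ} (f g : Cube n → Bool) : ℝ :=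
  (hammingDist f g : ℝ) / 2 ^ n

/-- Distance of `f` to a (nonempty) property `P`: the minimum of `funDist f g` over `g ∈ P`. -/
noncomputable def distToProperty {n : ℕ} (f : Cube n → Bool) (P : Set (Cube n → Bool)) : ℝ :=
  sInf (funDist f '' P)

theorem const_false_mem_kMonotone (n k : ℕ) : (fun _ => false) ∈ kMonotone n k := by
  rintro ⟨x, -, h, -⟩
  exact absurd h (by simp)

theorem exists_distToProperty_eq {n : ℕ} (f : Cube n → Bool) {P : Set (Cube n → Bool)}
    (hP : P.Nonempty) : ∃ g ∈ P, distToProperty f P = funDist f g := by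
  obtain ⟨g, hg, h⟩ := (hP.image (funDist f)).csInf_mem ((Set.toFinite P).image _)
  exact ⟨g, hg, h.symm⟩

theorem le_distToProperty_iff {n : ℕ} (f : Cube n → Bool) {P : Set (Cube n → Bool)}
    (hP : P.Nonempty) (ε : ℝ) : ε ≤ distToProperty f P ↔ ∀ g ∈ P, ε ≤ funDist f g := by
  rw [distToProperty, le_csInf_iff ((Set.toFinite P).image _).bddBelow (hP.image _)]
  simp

/-- A non-adaptive randomized algorithm making at most `q` queries to an unknown function on
`{0,1}^n`. The internal randomness `ω` alone determines the set of queried points; the answer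
depends on `ω` and on the values of the function at the queried points only. -/
structure NonAdaptiveAlgorithm (n q : ℕ) (Ω : Type*) [MeasurableSpace Ω] where
  queries : Ω → Finset (Cube n)
  card_queries_le : ∀ ω, (queries ω).card ≤ q
  accept : (ω : Ω) → ({x : Cube n // x ∈ queries ω} → Bool) → Bool
  measurableSet_accept : ∀ f : Cube n → Bool,
    MeasurableSet {ω | accept ω (fun x => f x.1) = true}

namespace NonAdaptiveAlgorithm

variable {n q : ℕ} {Ω : Type*} [MeasurableSpace Ω]

/-- The event that the algorithm accepts `f`. -/
def acceptEvent (T : NonAdaptiveAlgorithm n q Ω) (f : Cube n → Bool) : Set Ω :=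
  {ω | T.accept ω (fun x => f x.1) = true}

/-- The event that the algorithm rejects `f`. -/
def rejectEvent (T : NonAdaptiveAlgorithm n q Ω) (f : Cube n → Bool) : Set Ω :=
  {ω | T.accept ω (fun x => f x.1) = false}

/-- With internal randomness distributed as `μ`, the algorithm is a one-sided tester for the
property `P` with proximity parameter `ε`: it accepts every `f ∈ P` with probability `1` and
rejects every `f` that is `ε`-far from `P` with probability at least `2/3`. -/
def IsOneSidedTester (T : NonAdaptiveAlgorithm n q Ω) (μ : MeasureTheory.Measure Ω)
    (P : Set (Cube n → Bool)) (ε : ℝ) : Prop :=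
  (∀ f ∈ P, μ.real (T.acceptEvent f) = 1) ∧
  (∀ f : Cube n → Bool, ε ≤ distToProperty f P → 2 / 3 ≤ μ.real (T.rejectEvent f))

end NonAdaptiveAlgorithm

end KMonotoneTesting

/-! A one-sided tester may reject only when its queries contain a full violation: by
`exists_kMonotone_eqOn`, values without a violation extend to a `k`-monotone function. Averaging
over a family of far functions (`exists_queries_violating`) then gives one fixed set of `q` queries
that contains violations for two thirds of the family.

The family is indexed by the sets `S` of about `n / 2^10` coordinates. In a band of `w` middle
levels, `w` of order `√n`, the function is the parity of the block of `b` consecutive values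
containing the weight on `S`; outside the band it is 0. The band holds `k + 1` periods and `b * k`
has order `√n`.

Far: with the coordinates outside `S` fixed, maximal chains inside `S` cross all the periods, and a
`k`-monotone function errs on a constant fraction of each crossing. Averaging over chains and using
that middle binomials have order `2^m / √m` gives constant distance
(`le_distToProperty_bandFunction`).

Hard to hit: a violation contains a pair of points whose increment has at most `w ≤ 8t` coordinates,
at least `t` of them in the sparse set `S` (`IsViolation.exists_increment`). For a fixed pair this
holds for at most a fraction `2^w (1/2^10)^t ≤ 4^(-t)` of all `S`, so `q^2` pairs cover two thirds
of them only if `2^t ≤ 2q` (`two_pow_le_of_violating`). Since `t ≥ √n / 6144`, this is more than the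
claimed bound needs. -/

namespace KMonotoneTesting

open Finset

/-! ### Alternating chains and extension of partial functions -/

/-- The points `c 0 ≺ c 1 ≺ ⋯ ≺ c (j - 1)` form a chain along which `f` takes the values
`1, 0, 1, …`. -/
def IsAltChain {n : ℕ} (f : Cube n → Bool) (j : ℕ) (c : ℕ → Cube n) : Prop :=
  (∀ i, i + 1 < j → c i < c (i + 1)) ∧ ∀ i < j, f (c i) = decide (Even i)

theorem IsAltChain.mono {n : ℕ} {f : Cube n → Bool} {j l : ℕ} {c : ℕ → Cube n}
    (h : IsAltChain f j c) (hl : l ≤ j) : IsAltChain f l c :=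
  ⟨fun i hi => h.1 i (by omega), fun i hi => h.2 i (by omega)⟩

theorem IsAltChain.lt {n : ℕ} {f : Cube n → Bool} {j : ℕ} {c : ℕ → Cube n}
    (h : IsAltChain f j c) {a b : ℕ} (hab : a < b) (hb : b < j) : c a < c b := by
  induction b, hab using Nat.le_induction with
  | base => exact h.1 a hb
  | succ b _ ih => exact (ih (by omega)).trans (h.1 b hb)

theorem IsAltChain.isViolation {n k : ℕ} {f : Cube n → Bool} {c : ℕ → Cube n}
    (h : IsAltChain f (k + 1) c) : IsViolation k f (fun i => c i) := by
  refine ⟨fun a b hab => h.lt hab b.2, by simpa using h.2 0 (by omega), fun i => ?_⟩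
  have h1 := h.2 i (by omega)
  have h2 := h.2 (i + 1) (by omega)
  simp only [Fin.val_castSucc, Fin.val_succ, h1, h2, ne_eq, decide_eq_decide, Nat.even_add_one]
  tauto

theorem IsViolation.apply_eq {n k : ℕ} {f : Cube n → Bool} {x : Fin (k + 1) → Cube n}
    (h : IsViolation k f x) (i : Fin (k + 1)) : f (x i) = decide (Even (i : ℕ)) := by
  induction i using Fin.induction with
  | zero => simpa using h.2.1
  | succ i ih =>
    have := h.2.2 i
    rw [ih] at this
    simp only [Fin.val_castSucc, Fin.val_succ, Nat.even_add_one] at this ⊢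
    by_cases he : Even (i : ℕ) <;> simp_all

/-- There is an alternating chain of length `j` inside `Q` and below `x`. -/
def HasAltChainBelow {n : ℕ} (f : Cube n → Bool) (Q : Finset (Cube n)) (x : Cube n) (j : ℕ) :
    Prop :=
  ∃ c, IsAltChain f j c ∧ ∀ i < j, c i ∈ Q ∧ c i ≤ x

theorem HasAltChainBelow.zero {n : ℕ} (f : Cube n → Bool) (Q : Finset (Cube n)) (x : Cube n) :
    HasAltChainBelow f Q x 0 :=
  ⟨fun _ => x, ⟨fun i hi => by omega, fun i hi => by omega⟩, fun i hi => by omega⟩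

/-- A chain whose parity does not match the value at its upper bound can be prolonged. -/
theorem HasAltChainBelow.succ {n : ℕ} {f : Cube n → Bool} {Q : Finset (Cube n)} {x : Cube n}
    {j : ℕ} (h : HasAltChainBelow f Q x j) (hx : x ∈ Q) (hf : f x = decide (Even j)) :
    HasAltChainBelow f Q x (j + 1) := by
  obtain ⟨c, ⟨h1, h2⟩, h3⟩ := h
  refine ⟨fun i => if i < j then c i else x, ⟨fun i hi => ?_, fun i hi => ?_⟩, fun i hi => ?_⟩
  · dsimp only
    rw [if_pos (by omega)]
    split_ifs with hij
    · exact h1 i hij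
    · refine lt_of_le_of_ne (h3 i (by omega)).2 fun he => ?_
      have := h2 i (by omega)
      obtain rfl : j = i + 1 := by omega
      rw [he, hf] at this
      simp only [decide_eq_decide, Nat.even_add_one] at this
      tauto
  · dsimp only
    split_ifs with hij
    · exact h2 i hij
    · obtain rfl : i = j := by omega
      exact hf
  · dsimp only
    split_ifs with hij
    · exact h3 i hij
    · exact ⟨hx, le_rfl⟩

/-- A partial function without a violation among the points of `Q` extends to a `k`-monotone
function. -/
theorem exists_kMonotone_eqOn {n k : ℕ} (f : Cube n → Bool) (Q : Finset (Cube n))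
    (h : ¬ ∃ x : Fin (k + 1) → Cube n, IsViolation k f x ∧ ∀ i, x i ∈ Q) :
    ∃ g ∈ kMonotone n k, ∀ x ∈ Q, g x = f x := by
  classical
  have hmax : ∀ x, ¬ HasAltChainBelow f Q x (k + 1) := by
    rintro x ⟨c, h1, h2⟩
    exact h ⟨_, h1.isViolation, fun i => (h2 i i.2).1⟩
  -- The extension will be the parity of the longest alternating chain of queried points below `x`.
  -- By `hmax`, capping the search at `k` loses nothing.
  set L : Cube n → ℕ := fun x => Nat.findGreatest (HasAltChainBelow f Q x) k with hL
  have hspec : ∀ x, HasAltChainBelow f Q x (L x) := fun x =>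
    Nat.findGreatest_spec (P := HasAltChainBelow f Q x) (Nat.zero_le k) (.zero f Q x)
  have hLk : ∀ x, L x ≤ k := fun x => Nat.findGreatest_le k
  have hnext : ∀ x, ¬ HasAltChainBelow f Q x (L x + 1) := by
    intro x hx
    rcases (hLk x).lt_or_eq with hlt | heq
    · have := Nat.le_findGreatest (P := HasAltChainBelow f Q x) (n := k) hlt hx
      change L x + 1 ≤ L x at this
      omega
    · exact hmax x (heq ▸ hx)
  have hmono : Monotone L := by
    intro x y hxy
    refine Nat.le_findGreatest (hLk x) ?_
    obtain ⟨c, h1, h2⟩ := hspec x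
    exact ⟨c, h1, fun i hi => ⟨(h2 i hi).1, (h2 i hi).2.trans hxy⟩⟩
  refine ⟨fun x => decide (Odd (L x)), ?_, fun x hx => ?_⟩
  · rintro ⟨x, hx⟩
    have hv := hx.apply_eq
    -- `L` is monotone, odd at the start of a violation and changes parity at each step, so it would
    -- reach `k + 1`.
    have hgrow : ∀ i : Fin (k + 1), (i : ℕ) + 1 ≤ L (x i) := by
      intro i
      induction i using Fin.induction with
      | zero =>
        have := hv 0
        simp only [Fin.val_zero, Even.zero, decide_true, decide_eq_true_eq] at this
        exact this.pos
      | succ i ih =>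
        have h1 := hmono (hx.1.monotone (Fin.castSucc_lt_succ (i := i)).le)
        have h2 : L (x i.castSucc) ≠ L (x i.succ) := fun he => hx.2.2 i (by simp only [he])
        simp only [Fin.val_castSucc, Fin.val_succ] at ih ⊢
        omega
    have := hgrow (Fin.last k)
    have := hLk (x (Fin.last k))
    simp only [Fin.val_last] at *
    omega
  -- If the parity disagreed with `f x`, the queried point `x` itself would prolong the longest
  -- chain.
  · have h1 := hnext x
    contrapose! h1
    refine (hspec x).succ hx ?_
    simp only [← Nat.not_odd_iff_even]
    revert h1
    cases f x <;> by_cases ho : Odd (L x) <;> simp [ho]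

/-! ### From testers to a fixed set of queries -/

/-- Almost surely, a one-sided tester rejects only functions with a violation among the queried
points. -/
theorem ae_exists_isViolation_of_reject {n q k : ℕ} {Ω : Type*} [MeasurableSpace Ω]
    {μ : MeasureTheory.Measure Ω} [MeasureTheory.IsProbabilityMeasure μ]
    {T : NonAdaptiveAlgorithm n q Ω}
    (hT : ∀ f ∈ kMonotone n k, μ.real (T.acceptEvent f) = 1) :
    ∀ᵐ ω ∂μ, ∀ f : Cube n → Bool, ω ∈ T.rejectEvent f →
      ∃ x : Fin (k + 1) → Cube n, IsViolation k f x ∧ ∀ i, x i ∈ T.queries ω := by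
  -- There are finitely many functions on the cube, so one null set serves them all.
  have h1 : ∀ᵐ ω ∂μ, ∀ g : Cube n → Bool, g ∈ kMonotone n k → ω ∈ T.acceptEvent g := by
    rw [MeasureTheory.ae_all_iff]
    intro g
    by_cases hg : g ∈ kMonotone n k
    · have := hT g hg
      have h2 : μ (T.acceptEvent g) = 1 := by
        rw [MeasureTheory.measureReal_def] at this
        rw [← ENNReal.ofReal_toReal (MeasureTheory.measure_ne_top μ _), this, ENNReal.ofReal_one]
      have h3 := (MeasureTheory.prob_compl_eq_zero_iff (T.measurableSet_accept g)).2 h2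
      filter_upwards [MeasureTheory.measure_eq_zero_iff_ae_notMem.1 h3] with ω hω _
      exact not_not.1 hω
    · exact Filter.Eventually.of_forall fun ω h => absurd h hg
  filter_upwards [h1] with ω hω f hf
  by_contra hv
  obtain ⟨g, hg, hgf⟩ := exists_kMonotone_eqOn f (T.queries ω) hv
  have h2 := hω g hg
  simp only [NonAdaptiveAlgorithm.acceptEvent, NonAdaptiveAlgorithm.rejectEvent,
    Set.mem_ofPred_eq] at h2 hf
  have h3 : (fun x : {x // x ∈ T.queries ω} => g x.1) = fun x => f x.1 :=
    funext fun x => hgf x.1 x.2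
  rw [h3, hf] at h2
  exact absurd h2 (by simp)

/-- Averaging over a family of functions far from `k`-monotone: some set of `q` queries contains
violations for two thirds of the family. -/
theorem exists_queries_violating {n q k : ℕ} {Ω : Type*} [MeasurableSpace Ω]
    {μ : MeasureTheory.Measure Ω} [MeasureTheory.IsProbabilityMeasure μ]
    {T : NonAdaptiveAlgorithm n q Ω} {ε : ℝ} (hT : T.IsOneSidedTester μ (kMonotone n k) ε)
    {ι : Type*} (s : Finset ι) (f : ι → Cube n → Bool)
    (hf : ∀ i ∈ s, ε ≤ distToProperty (f i) (kMonotone n k)) :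
    ∃ Q : Finset (Cube n), #Q ≤ q ∧ ∃ v ⊆ s, 2 / 3 * (#s : ℝ) ≤ #v ∧
      ∀ i ∈ v, ∃ x : Fin (k + 1) → Cube n, IsViolation k (f i) x ∧ ∀ j, x j ∈ Q := by
  classical
  have hmeas : ∀ i, MeasurableSet (T.rejectEvent (f i)) := by
    intro i
    have : T.rejectEvent (f i) = (T.acceptEvent (f i))ᶜ := by
      ext ω
      simp [NonAdaptiveAlgorithm.rejectEvent, NonAdaptiveAlgorithm.acceptEvent]
    rw [this]
    exact (T.measurableSet_accept (f i)).compl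
  -- `F` counts the rejected members of the family; some outcome outside the null set attains at
  -- least its mean.
  set F : Ω → ℝ := fun ω => ∑ i ∈ s, (T.rejectEvent (f i)).indicator (fun _ => (1 : ℝ)) ω with hF
  have hint : MeasureTheory.Integrable F μ :=
    MeasureTheory.integrable_finsetSum _ fun i _ =>
      (MeasureTheory.integrable_const (1 : ℝ)).indicator (hmeas i)
  have hge : 2 / 3 * (#s : ℝ) ≤ ∫ ω, F ω ∂μ := by
    rw [MeasureTheory.integral_finsetSum _ fun i _ =>
      (MeasureTheory.integrable_const (1 : ℝ)).indicator (hmeas i)]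
    calc 2 / 3 * (#s : ℝ) = ∑ i ∈ s, (2 / 3 : ℝ) := by simp [mul_comm]
      _ ≤ _ := by
        refine sum_le_sum fun i hi => ?_
        rw [MeasureTheory.integral_indicator_const _ (hmeas i)]
        simpa using hT.2 (f i) (hf i hi)
  have hnull := ae_exists_isViolation_of_reject hT.1
  rw [MeasureTheory.ae_iff] at hnull
  obtain ⟨ω, hω, hle⟩ := MeasureTheory.exists_notMem_null_integral_le hint hnull
  simp only [Set.mem_ofPred_eq, not_not] at hω
  refine ⟨T.queries ω, T.card_queries_le ω, {i ∈ s | ω ∈ T.rejectEvent (f i)},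
    filter_subset _ _, ?_, fun i hi => hω _ (mem_filter.1 hi).2⟩
  refine (hge.trans hle).trans (le_of_eq ?_)
  simp [hF, Set.indicator_apply]

/-! ### Hypergeometric tail -/

/-- The number of `S` containing a fixed `t`-set. -/
theorem card_filter_subset_powersetCard {α : Type*} [Fintype α] [DecidableEq α] (D : Finset α)
    (s : ℕ) (hD : #D ≤ s) :
    #{S ∈ powersetCard s (univ : Finset α) | D ⊆ S} = (Fintype.card α - #D).choose (s - #D) := by
  rw [← card_compl, ← card_powersetCard]
  refine card_bij' (fun S _ => S \ D) (fun R _ => R ∪ D) ?_ ?_ ?_ ?_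
  · intro S hS
    simp only [mem_filter, mem_powersetCard, subset_univ, true_and] at hS ⊢
    refine ⟨fun x hx => by simpa using (mem_sdiff.1 hx).2, ?_⟩
    rw [card_sdiff_of_subset hS.2, hS.1]
  · intro R hR
    simp only [mem_filter, mem_powersetCard, subset_univ, true_and] at hR ⊢
    refine ⟨?_, subset_union_right⟩
    rw [card_union_of_disjoint (disjoint_left.2 fun x hx => by simpa using hR.1 hx), hR.2]
    omega
  · intro S hS
    simp only [mem_filter] at hS
    exact sdiff_union_of_subset hS.2
  · intro R hR
    simp only [mem_powersetCard] at hR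
    rw [union_sdiff_right]
    exact sdiff_eq_self_of_disjoint (disjoint_left.2 fun x hx => by simpa using hR.1 hx)

/-- The quotient of the two binomials is the product of `(s - i) / (n - i)` over `i < t`, and each
factor is at most `s / n`. -/
theorem choose_sub_mul_pow_le {n s t : ℕ} (hs : s ≤ n) (ht : t ≤ s) :
    (n - t).choose (s - t) * n ^ t ≤ s ^ t * n.choose s := by
  induction t with
  | zero => simp
  | succ t ih =>
    have ih := ih (by omega)
    obtain ⟨a, ha⟩ : ∃ a, s = t + 1 + a := ⟨s - (t + 1), by omega⟩
    obtain ⟨b, hb⟩ : ∃ b, n = t + 1 + a + b := ⟨n - s, by omega⟩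
    have e1 : n - t = a + b + 1 := by omega
    have e2 : s - t = a + 1 := by omega
    have e3 : n - (t + 1) = a + b := by omega
    have e4 : s - (t + 1) = a := by omega
    rw [e1, e2] at ih
    rw [e3, e4]
    have key := Nat.add_one_mul_choose_eq (a + b) a
    have h1 : (a + b).choose a * n ≤ (a + b + 1).choose (a + 1) * s := by
      refine Nat.le_of_mul_le_mul_left (c := a + b + 1) ?_ (by omega)
      calc (a + b + 1) * ((a + b).choose a * n) = (a + b + 1).choose (a + 1) * ((a + 1) * n) := by
            rw [← mul_assoc, key]; ring
        _ ≤ (a + b + 1).choose (a + 1) * ((a + b + 1) * s) := by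
            refine Nat.mul_le_mul_left _ ?_
            subst hb ha
            nlinarith [Nat.zero_le (t * b)]
        _ = _ := by ring
    calc (a + b).choose a * n ^ (t + 1) = ((a + b).choose a * n) * n ^ t := by ring
      _ ≤ ((a + b + 1).choose (a + 1) * s) * n ^ t := Nat.mul_le_mul_right _ h1
      _ = ((a + b + 1).choose (a + 1) * n ^ t) * s := by ring
      _ ≤ (s ^ t * n.choose s) * s := Nat.mul_le_mul_right _ ih
      _ = _ := by ring

/-- Union bound for the hypergeometric tail. -/
theorem card_filter_le_card_inter_mul_pow_le {α : Type*} [Fintype α] [DecidableEq α]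
    (D : Finset α) {s t w : ℕ} (hs : s ≤ Fintype.card α) (ht : t ≤ s) (hD : #D ≤ w) :
    #{S ∈ powersetCard s (univ : Finset α) | t ≤ #(D ∩ S)} * Fintype.card α ^ t ≤
      2 ^ w * (s ^ t * (Fintype.card α).choose s) := by
  have h1 : {S ∈ powersetCard s (univ : Finset α) | t ≤ #(D ∩ S)} ⊆
      (powersetCard t D).biUnion
        fun E => {S ∈ powersetCard s (univ : Finset α) | E ⊆ S} := by
    intro S hS
    rw [mem_filter] at hS
    obtain ⟨E, hE, hc⟩ := exists_subset_card_eq hS.2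
    rw [mem_biUnion]
    exact ⟨E, mem_powersetCard.2 ⟨hE.trans inter_subset_left, hc⟩,
      mem_filter.2 ⟨hS.1, hE.trans inter_subset_right⟩⟩
  have h2 : #{S ∈ powersetCard s (univ : Finset α) | t ≤ #(D ∩ S)} ≤
      #(powersetCard t D) * (Fintype.card α - t).choose (s - t) := by
    refine (card_le_card h1).trans (card_biUnion_le_card_mul _ _ _ fun E hE => ?_)
    have hc := (mem_powersetCard.1 hE).2
    rw [card_filter_subset_powersetCard E s (by omega), hc]
  have h3 : #(powersetCard t D) ≤ 2 ^ w := by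
    rw [card_powersetCard]
    exact (Nat.choose_le_two_pow _ _).trans (Nat.pow_le_pow_right (by norm_num) hD)
  calc _ ≤ (#(powersetCard t D) * (Fintype.card α - t).choose (s - t)) * Fintype.card α ^ t :=
        Nat.mul_le_mul_right _ h2
    _ = #(powersetCard t D) * ((Fintype.card α - t).choose (s - t) * Fintype.card α ^ t) := by ring
    _ ≤ _ := Nat.mul_le_mul h3 (choose_sub_mul_pow_le hs ht)

/-! ### Binomial coefficients near the middle -/

/-- The quotient of the two sides is monotone in `h` because `4h(h + 1) ≤ (2h + 1)^2`; equality
holds at `h = 1`. -/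
theorem sixteen_pow_le_centralBinom_sq {h : ℕ} (hh : 1 ≤ h) :
    16 ^ h ≤ h.centralBinom ^ 2 * (4 * h) := by
  induction h, hh using Nat.le_induction with
  | base => simp [Nat.centralBinom, Nat.choose]
  | succ h hh ih =>
    have key := Nat.succ_mul_centralBinom_succ h
    refine Nat.le_of_mul_le_mul_left (c := h + 1) ?_ (by omega)
    calc (h + 1) * 16 ^ (h + 1) = 16 ^ h * (16 * (h + 1)) := by ring
      _ ≤ (h.centralBinom ^ 2 * (4 * h)) * (16 * (h + 1)) := Nat.mul_le_mul_right _ ih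
      _ = h.centralBinom ^ 2 * (64 * (h * (h + 1))) := by ring
      _ ≤ h.centralBinom ^ 2 * (16 * (2 * h + 1) ^ 2) := Nat.mul_le_mul_left _ (by nlinarith)
      _ = 4 * (2 * (2 * h + 1) * h.centralBinom) ^ 2 := by ring
      _ = 4 * ((h + 1) * (h + 1).centralBinom) ^ 2 := by rw [key]
      _ = _ := by ring

/-- One step away from the middle costs a factor `(h - a) / (h + a + 1) ≥ 1 - (2a + 1) / h`. The
losses `2i + 1` for `i < a` add up to `a^2`, and a product of such factors is at least one minus the
sum of the losses. -/
theorem centralBinom_mul_le_choose {h a : ℕ} (hh : 1 ≤ h) (ha : a ≤ h) :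
    (h.centralBinom : ℝ) * (1 - a ^ 2 / h) ≤ (2 * h).choose (h - a) := by
  induction a with
  | zero => simp [Nat.centralBinom]
  | succ a ih =>
    have ih := ih (by omega)
    obtain ⟨d, hd⟩ : ∃ d, h = a + 1 + d := ⟨h - (a + 1), by omega⟩
    have e1 : h - a = d + 1 := by omega
    have e2 : h - (a + 1) = d := by omega
    rw [e1] at ih
    rw [e2]
    have key := Nat.choose_succ_right_eq (2 * h) d
    have e3 : 2 * h - d = h + a + 1 := by omega
    rw [e3] at key
    have key' : ((2 * h).choose (d + 1) : ℝ) * (d + 1) = (2 * h).choose d * (h + a + 1) := by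
      exact_mod_cast key
    have hd' : (d : ℝ) + 1 = h - a := by
      rw [hd]; push_cast; ring
    have hpos : (0 : ℝ) < h := by exact_mod_cast hh
    have hpos2 : (0 : ℝ) < h + a + 1 := by positivity
    have hC : (0 : ℝ) ≤ h.centralBinom := by positivity
    by_cases hneg : (1 : ℝ) - ((a + 1 : ℕ) : ℝ) ^ 2 / h ≤ 0
    · exact (mul_nonpos_of_nonneg_of_nonpos hC hneg).trans (by positivity)
    push Not at hneg
    have e4 : ((2 * h).choose d : ℝ) = (2 * h).choose (d + 1) * ((h - a) / (h + a + 1)) := by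
      rw [← hd']
      field_simp
      linarith
    have hq : 1 - (2 * a + 1 : ℝ) / h ≤ (h - a) / (h + a + 1) := by
      rw [le_div_iff₀ hpos2, sub_mul, div_mul_eq_mul_div, sub_le_iff_le_add,
        ← sub_le_iff_le_add', le_div_iff₀ hpos]
      nlinarith [(Nat.cast_nonneg a : (0 : ℝ) ≤ a)]
    have hq0 : (0 : ℝ) ≤ (h - a) / (h + a + 1) := by
      rw [← hd']; positivity
    rw [e4]
    refine le_trans ?_ (mul_le_mul_of_nonneg_right ih hq0)
    rw [mul_assoc]
    refine mul_le_mul_of_nonneg_left ?_ hC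
    have h1 : (a : ℝ) ^ 2 / h ≤ 1 := by
      rw [div_le_one hpos]
      rw [sub_pos, div_lt_one hpos] at hneg
      push_cast at hneg
      nlinarith [(Nat.cast_nonneg a : (0 : ℝ) ≤ a)]
    calc (1 : ℝ) - ((a + 1 : ℕ) : ℝ) ^ 2 / h = 1 - (a : ℝ) ^ 2 / h - (2 * a + 1 : ℝ) / h := by
          push_cast; ring
      _ ≤ (1 - (a : ℝ) ^ 2 / h) * (1 - (2 * a + 1 : ℝ) / h) := by
          have : (0 : ℝ) ≤ (a : ℝ) ^ 2 / h * ((2 * a + 1 : ℝ) / h) := by positivity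
          nlinarith
      _ ≤ _ := mul_le_mul_of_nonneg_left hq (by linarith)

theorem four_pow_le_choose_mul_sqrt {h a i : ℕ} (hh : 1 ≤ h) (ha : 2 * a ^ 2 ≤ h)
    (h1 : h ≤ i + a) (h2 : i ≤ h + a) :
    (4 : ℝ) ^ h / (4 * √h) ≤ (2 * h).choose i := by
  have hpos : (0 : ℝ) < h := by exact_mod_cast hh
  have hah : a ≤ h := by nlinarith
  have main : ∀ d ≤ a, (4 : ℝ) ^ h / (4 * √h) ≤ (2 * h).choose (h - d) := by
    intro d hd
    refine le_trans ?_ (centralBinom_mul_le_choose hh (hd.trans hah))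
    have e1 : (1 : ℝ) / 2 ≤ 1 - d ^ 2 / h := by
      have h3 : 2 * (d : ℝ) ^ 2 ≤ h := by
        exact_mod_cast (Nat.mul_le_mul_left 2 (Nat.pow_le_pow_left hd 2)).trans ha
      rw [le_sub_comm, div_le_iff₀ hpos]
      linarith
    have e2 : (4 : ℝ) ^ h / (2 * √h) ≤ h.centralBinom := by
      rw [div_le_iff₀ (by positivity)]
      refine le_of_sq_le_sq ?_ (by positivity)
      have := sixteen_pow_le_centralBinom_sq hh
      have : (16 : ℝ) ^ h ≤ h.centralBinom ^ 2 * (4 * h) := by exact_mod_cast this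
      rw [mul_pow, mul_pow, Real.sq_sqrt hpos.le, ← pow_mul, mul_comm h 2, pow_mul]
      norm_num
      linarith
    calc (4 : ℝ) ^ h / (4 * √h) = (4 : ℝ) ^ h / (2 * √h) * (1 / 2) := by field_simp; norm_num
      _ ≤ _ := mul_le_mul e2 e1 (by norm_num) (by positivity)
  rcases le_total i h with hi | hi
  · have := main (h - i) (by omega)
    rwa [Nat.sub_sub_self hi] at this
  · have := main (i - h) (by omega)
    rwa [← Nat.choose_symm_of_eq_add (n := 2 * h) (a := i) (b := h - (i - h)) (by omega)] at this

/-! ### Averaging over maximal chains -/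

/-- Averaging over maximal chains: if each one meets `P` in at least `B` levels from `I`, then `P`
holds for at least `B` levels worth of sets, up to the smallest level. -/
theorem mul_le_card_of_forall_numbering {X : Type*} [Fintype X] [DecidableEq X]
    (P : Finset X → Prop) [DecidablePred P] (I : Finset ℕ) (B : ℕ) (K : ℝ)
    (hI : ∀ i ∈ I, i ≤ Fintype.card X) (hK : ∀ i ∈ I, K ≤ (Fintype.card X).choose i)
    (hB : ∀ f : Numbering X, B ≤ #{i ∈ I | P {x | (f x : ℕ) < i}}) :
    K * B ≤ #{A : Finset X | #A ∈ I ∧ P A} := by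
  set N := Fintype.card X with hN
  set G : Finset (Finset X) := {A : Finset X | #A ∈ I ∧ P A} with hG
  have hcard : ∀ (f : Numbering X) (i : ℕ), i ≤ N →
      #({x | (f x : ℕ) < i} : Finset X) = i := by
    intro f i hi
    have : ({x | (f x : ℕ) < i} : Finset X) =
        ({j : Fin N | (j : ℕ) < i} : Finset (Fin N)).map f.symm.toEmbedding := by
      ext x
      simp [mem_map_equiv]
    rw [this, card_map, Fin.card_filter_val_lt, min_eq_right hi]
  have h1 : ∀ f : Numbering X, B ≤ #{A ∈ G | f ∈ Numbering.prefixed A} := by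
    intro f
    refine (hB f).trans (card_le_card_of_injOn (fun i => ({x | (f x : ℕ) < i} : Finset X)) ?_ ?_)
    · intro i hi
      simp only [coe_filter, Set.mem_ofPred_eq] at hi
      have hc := hcard f i (hI i hi.1)
      simp only [hG, coe_filter, mem_filter, mem_univ, true_and, Numbering.mem_prefixed,
        Numbering.IsPrefix, Set.mem_ofPred_eq, hc, hi.1, hi.2, implies_true, and_self]
    · intro i hi j hj hij
      simp only [coe_filter, Set.mem_ofPred_eq] at hi hj
      rw [← hcard f i (hI i hi.1), ← hcard f j (hI j hj.1)]
      exact congrArg card hij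
  -- Double counting of pairs of a numbering and a set of `G` that is one of its initial segments. A
  -- set `A` is a segment of `(#A)! (N - #A)!` numberings, which is at most `N! / K` when `K` is
  -- positive.
  have h2 : (N.factorial : ℝ) * B ≤ ∑ A ∈ G, (#(Numbering.prefixed A) : ℝ) := by
    have : N.factorial * B ≤ ∑ A ∈ G, #(Numbering.prefixed A) := by
      calc N.factorial * B = ∑ _f : Numbering X, B := by
            simp [Fintype.card_numbering, hN]
        _ ≤ ∑ f : Numbering X, #{A ∈ G | f ∈ Numbering.prefixed A} :=
            sum_le_sum fun f _ => h1 f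
        _ = ∑ A ∈ G, #(Numbering.prefixed A) := by
            simp only [card_filter]
            rw [sum_comm]
            refine sum_congr rfl fun A _ => ?_
            simp [Numbering.prefixed]
    exact_mod_cast this
  have hfac : (0 : ℝ) < N.factorial := by positivity
  have h3 : ∀ A ∈ G, K * #(Numbering.prefixed A) ≤ N.factorial := by
    intro A hA
    simp only [hG, mem_filter, mem_univ, true_and] at hA
    rw [Numbering.card_prefixed]
    calc K * (((#A).factorial * (N - #A).factorial : ℕ) : ℝ)
        ≤ (N.choose #A : ℝ) * (((#A).factorial * (N - #A).factorial : ℕ) : ℝ) :=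
          mul_le_mul_of_nonneg_right (hK _ hA.1) (by positivity)
      _ = N.factorial := by
          rw [← Nat.choose_mul_factorial_mul_factorial (hI _ hA.1)]
          push_cast; ring
  rcases le_total K 0 with hK0 | hK0
  · exact (mul_nonpos_of_nonpos_of_nonneg hK0 (by positivity)).trans (by positivity)
  have h4 : K * (N.factorial * B) ≤ N.factorial * #G :=
    calc K * (N.factorial * B) ≤ K * ∑ A ∈ G, (#(Numbering.prefixed A) : ℝ) :=
          mul_le_mul_of_nonneg_left h2 hK0
      _ = ∑ A ∈ G, K * #(Numbering.prefixed A) := mul_sum _ _ _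
      _ ≤ ∑ A ∈ G, (N.factorial : ℝ) := sum_le_sum h3
      _ = _ := by simp [mul_comm]
  refine le_of_mul_le_mul_left ?_ hfac
  linarith

/-! ### Band functions and their violations -/

/-- The number of ones of `x` among the coordinates in `S`. -/
def weightOn {n : ℕ} (S : Finset (Fin n)) (x : Cube n) : ℕ :=
  #{i ∈ S | x i = true}

theorem weightOn_mono {n : ℕ} (S : Finset (Fin n)) {x z : Cube n} (h : x ≤ z) :
    weightOn S x ≤ weightOn S z :=
  card_le_card fun i hi => by
    rw [mem_filter] at hi ⊢
    exact ⟨hi.1, Bool.eq_true_of_true_le (hi.2 ▸ h i)⟩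

/-- The coordinates that are one in `z` and zero in `x`. -/
def increment {n : ℕ} (x z : Cube n) : Finset (Fin n) :=
  {i | x i = false ∧ z i = true}

theorem weightOn_add_card_increment {n : ℕ} (S : Finset (Fin n)) {x z : Cube n} (h : x ≤ z) :
    weightOn S x + #(increment x z ∩ S) = weightOn S z := by
  rw [weightOn, weightOn, ← card_union_of_disjoint]
  · congr 1
    ext i
    have : x i = true → z i = true := fun hx => Bool.eq_true_of_true_le (hx ▸ h i)
    simp only [increment, mem_union, mem_filter, mem_inter, mem_univ, true_and]
    cases hx : x i <;> cases hz : z i <;> simp_all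
  · rw [disjoint_left]
    intro i hi hi'
    simp only [increment, mem_filter, mem_inter, mem_univ, true_and] at hi hi'
    simp_all

/-- Inside the band of weights `[t₀, t₀ + w)`, the function alternates between blocks of `b`
consecutive weights on `S`; outside the band it is `0`. -/
def bandFunction {n : ℕ} (S : Finset (Fin n)) (b t₀ w : ℕ) : Cube n → Bool := fun x =>
  decide (t₀ ≤ weightOn univ x ∧ weightOn univ x < t₀ + w ∧ Even (weightOn S x / b))

/-- A violation of the band function makes a large part of its total increment within `S`. -/
theorem IsViolation.exists_increment {n k b t₀ w : ℕ} (hk : 2 ≤ k) (hb : 1 ≤ b)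
    {S : Finset (Fin n)} {x : Fin (k + 1) → Cube n}
    (hx : IsViolation k (bandFunction S b t₀ w) x) :
    ∃ a c, #(increment (x a) (x c)) ≤ w ∧
      (2 * (k / 2) - 1) * b ≤ #(increment (x a) (x c) ∩ S) := by
  -- The last even index: the value there is 1, as at index 0, so both points, and with them all
  -- points between, lie in the band.
  obtain ⟨J, hJ⟩ : ∃ J, J = 2 * (k / 2) := ⟨_, rfl⟩
  have hJk : J < k + 1 := by omega
  have hval := hx.apply_eq
  have h0 := hval 0
  have h1 := hval ⟨J, hJk⟩
  have hJe : Even J := ⟨k / 2, by omega⟩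
  simp only [Fin.val_zero, Even.zero, hJe, decide_true, bandFunction, decide_eq_true_eq] at h0 h1
  have hle : x 0 ≤ x ⟨J, hJk⟩ := hx.1.monotone (Fin.zero_le _)
  -- Inside the band the value is the parity of the block, so each step of the violation enters a
  -- later block.
  have hblock : ∀ i (hi : i < k + 1), i ≤ J →
      weightOn S (x 0) / b + i ≤ weightOn S (x ⟨i, hi⟩) / b ∧
        (Even (weightOn S (x ⟨i, hi⟩) / b) ↔ Even i) := by
    intro i hi hiJ
    have hpar : Even (weightOn S (x ⟨i, hi⟩) / b) ↔ Even i := by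
      have h2 := hval ⟨i, hi⟩
      have h3 := weightOn_mono univ (hx.1.monotone (Fin.zero_le (⟨i, hi⟩ : Fin (k + 1))))
      have h4 := weightOn_mono univ
        (hx.1.monotone (show (⟨i, hi⟩ : Fin (k + 1)) ≤ ⟨J, hJk⟩ from hiJ))
      simp only [bandFunction, decide_eq_decide] at h2
      rw [← h2]
      exact ⟨fun h => ⟨by omega, by omega, h⟩, fun h => h.2.2⟩
    refine ⟨?_, hpar⟩
    induction i with
    | zero => exact le_rfl
    | succ i ih =>
      have hpar' : Even (weightOn S (x ⟨i, by omega⟩) / b) ↔ Even i := by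
        have h2 := hval ⟨i, by omega⟩
        have h3 := weightOn_mono univ
          (hx.1.monotone (Fin.zero_le (⟨i, by omega⟩ : Fin (k + 1))))
        have h4 := weightOn_mono univ
          (hx.1.monotone (show (⟨i, by omega⟩ : Fin (k + 1)) ≤ ⟨J, hJk⟩ from by
            exact (Nat.le_succ i).trans hiJ))
        simp only [bandFunction, decide_eq_decide] at h2
        rw [← h2]
        exact ⟨fun h => ⟨by omega, by omega, h⟩, fun h => h.2.2⟩
      have ih := ih (by omega) (by omega) hpar'
      have h5 : weightOn S (x ⟨i, by omega⟩) / b ≤ weightOn S (x ⟨i + 1, hi⟩) / b :=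
        Nat.div_le_div_right (weightOn_mono S (hx.1.monotone (show
          (⟨i, by omega⟩ : Fin (k + 1)) ≤ ⟨i + 1, hi⟩ from Nat.le_succ i)))
      have h6 : weightOn S (x ⟨i, by omega⟩) / b ≠ weightOn S (x ⟨i + 1, hi⟩) / b := by
        intro he
        rw [he, hpar, Nat.even_add_one] at hpar'
        tauto
      omega
  refine ⟨0, ⟨J, hJk⟩, ?_, ?_⟩
  · have := weightOn_add_card_increment univ hle
    rw [inter_univ] at this
    omega
  · have h2 := (hblock J hJk le_rfl).1
    have h3 := weightOn_add_card_increment S hle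
    -- The first point may sit at the end of its block, so only `J - 1` full blocks are certain to
    -- be crossed.
    have h4 := (Nat.le_div_iff_mul_le (by omega)).1 h2
    have h5 : weightOn S (x 0) < (weightOn S (x 0) / b + 1) * b := by
      rw [mul_comm]; exact Nat.lt_mul_div_succ _ (by omega)
    rw [← hJ]
    obtain ⟨J', rfl⟩ : ∃ J', J = J' + 1 := ⟨J - 1, by omega⟩
    rw [Nat.add_sub_cancel]
    have h6 : (weightOn S (x 0) / b + (J' + 1)) * b =
        (weightOn S (x 0) / b + 1) * b + J' * b := by ring
    omega

/-! ### Distance of band functions from `k`-monotone functions -/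

/-- A `k`-monotone function cannot have the values `1, 0` on more than `k / 2` successive pairs of
a chain. -/
theorem two_mul_card_le_of_mem_kMonotone {n k : ℕ} {g : Cube n → Bool} (hg : g ∈ kMonotone n k)
    (c d : ℕ → Cube n) (G : Finset ℕ) (hcd : ∀ l ∈ G, c l < d l)
    (hdc : ∀ l ∈ G, ∀ m ∈ G, l < m → d l < c m)
    (hc : ∀ l ∈ G, g (c l) = true) (hd : ∀ l ∈ G, g (d l) = false) : 2 * #G ≤ k := by
  by_contra! hlt
  -- With `e` enumerating `G` in increasing order, `c (e 0) < d (e 0) < c (e 1) < ⋯` is an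
  -- alternating chain of `2 * #G` points.
  set e : ℕ → ℕ := Nat.nth (· ∈ G) with he
  have hfin : (Set.ofPred (· ∈ G)).Finite := G.finite_toSet
  have hcard : #hfin.toFinset = #G := by
    congr 1
    ext i
    simp
  have hmem : ∀ i < #G, e i ∈ G := fun i hi =>
    Nat.nth_mem_of_lt_card hfin (by rwa [hcard])
  have hlt' : ∀ i j, i < j → j < #G → e i < e j := fun i j hij hj =>
    Nat.nth_lt_nth_of_lt_card hfin hij (by rwa [hcard])
  have hchain : IsAltChain g (2 * #G) fun i =>
      if Even i then c (e (i / 2)) else d (e (i / 2)) := by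
    refine ⟨fun i hi => ?_, fun i hi => ?_⟩
    · rcases Nat.even_or_odd i with hi' | hi'
      · have : ¬ Even (i + 1) := by rw [Nat.even_add_one]; tauto
        obtain ⟨m, rfl⟩ := hi'
        have e1 : (m + m) / 2 = m := by omega
        have e2 : (m + m + 1) / 2 = m := by omega
        simp only [this, if_false, e1, e2, Even.add_self, if_true]
        exact hcd _ (hmem _ (by omega))
      · have h2 : Even (i + 1) := hi'.add_one
        have h3 : ¬ Even i := Nat.not_even_iff_odd.2 hi'
        obtain ⟨m, rfl⟩ := hi'
        have e1 : (2 * m + 1) / 2 = m := by omega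
        have e2 : (2 * m + 1 + 1) / 2 = m + 1 := by omega
        simp only [h2, h3, if_false, if_true, e1, e2]
        exact hdc _ (hmem _ (by omega)) _ (hmem _ (by omega)) (hlt' _ _ (by omega) (by omega))
    · by_cases hi' : Even i
      · simp only [hi', if_true, decide_true]
        exact hc _ (hmem _ (by omega))
      · simp only [hi', if_false, decide_false]
        exact hd _ (hmem _ (by omega))
  exact hg ⟨_, (hchain.mono (by omega)).isViolation⟩

/-- Along a chain on which `f` alternates between blocks of length `b`, a `k`-monotone function
differs from `f` often. -/
theorem le_card_ne_of_chain {n k b i₀ N : ℕ} (hb : 1 ≤ b) {f g : Cube n → Bool}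
    (hg : g ∈ kMonotone n k) (c : ℕ → Cube n) (hc : ∀ i j, i < j → j ≤ N → c i < c j)
    (hN : i₀ + 2 * b * (k + 1) ≤ N + 1)
    (hf : ∀ i ∈ Ico i₀ (i₀ + 2 * b * (k + 1)), f (c i) = decide (Even (i / b))) :
    b * (k - k / 2) ≤ #{i ∈ Ico i₀ (i₀ + 2 * b * (k + 1)) | f (c i) ≠ g (c i)} := by
  -- Period `a` is the first one starting after `i₀`. Alignment costs at most one of the `k + 1`
  -- periods, leaving `k` complete ones.
  obtain ⟨a, ha1, ha2⟩ : ∃ a, i₀ ≤ 2 * b * a ∧ 2 * b * a ≤ i₀ + 2 * b := by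
    refine ⟨i₀ / (2 * b) + 1, ?_, ?_⟩
    · exact (Nat.lt_mul_div_succ i₀ (by omega : 0 < 2 * b)).le
    · rw [Nat.mul_add_one]
      have := Nat.mul_div_le i₀ (2 * b)
      omega
  -- Offset `r` in the 1-block of the `l`-th period; adding `b` gives the matching index in the
  -- 0-block. For fixed `r`, `g` can be right on both indices for at most `k / 2` of the `k` pairs.
  set p : ℕ → ℕ → ℕ := fun r l => 2 * b * (a + l) + r with hp
  have hrange : ∀ r < b, ∀ l < k, p r l ∈ Ico i₀ (i₀ + 2 * b * (k + 1)) ∧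
      p r l + b ∈ Ico i₀ (i₀ + 2 * b * (k + 1)) := by
    intro r hr l hl
    have h1 : 2 * b * (a + l + 1) ≤ 2 * b * (a + k) := Nat.mul_le_mul_left _ (by omega)
    simp only [mem_Ico, hp]
    rw [Nat.mul_add_one] at h1 ⊢
    rw [Nat.mul_add] at h1 ⊢
    rw [Nat.mul_add] at h1
    omega
  have hdiv : ∀ r < b, ∀ l, p r l / b = 2 * (a + l) ∧ (p r l + b) / b = 2 * (a + l) + 1 := by
    intro r hr l
    have : p r l / b = 2 * (a + l) := by
      rw [show p r l = r + b * (2 * (a + l)) by simp only [hp]; ring,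
        Nat.add_mul_div_left _ _ (by omega), Nat.div_eq_of_lt hr, zero_add]
    exact ⟨this, by rw [Nat.add_div_right _ (by omega), this]⟩
  have hmod : ∀ r < b, ∀ l, p r l % b = r := by
    intro r hr l
    rw [show p r l = r + b * (2 * (a + l)) by simp only [hp]; ring, Nat.add_mul_mod_self_left,
      Nat.mod_eq_of_lt hr]
  set bad : ℕ → Finset ℕ := fun r => {l ∈ range k | f (c (p r l)) ≠ g (c (p r l)) ∨
    f (c (p r l + b)) ≠ g (c (p r l + b))} with hbad
  have hbadcard : ∀ r < b, k - k / 2 ≤ #(bad r) := by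
    intro r hr
    set G : Finset ℕ := {l ∈ range k | ¬ (f (c (p r l)) ≠ g (c (p r l)) ∨
      f (c (p r l + b)) ≠ g (c (p r l + b)))} with hG
    have hsum : #(bad r) + #G = k := by
      rw [hbad, hG, card_filter_add_card_filter_not, card_range]
    have hGk : ∀ l ∈ G, l < k ∧ f (c (p r l)) = g (c (p r l)) ∧
        f (c (p r l + b)) = g (c (p r l + b)) := by
      intro l hl
      simpa [hG, not_or] using hl
    have := two_mul_card_le_of_mem_kMonotone hg (fun l => c (p r l)) (fun l => c (p r l + b)) G
      ?_ ?_ ?_ ?_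
    · omega
    · intro l hl
      have := mem_Ico.1 (hrange r hr l (hGk l hl).1).2
      exact hc _ _ (by omega) (by omega)
    · intro l hl m hm hlm
      have h1 := mem_Ico.1 (hrange r hr m (hGk m hm).1).1
      refine hc _ _ ?_ (by omega)
      have h2 : 2 * b * (a + l + 1) ≤ 2 * b * (a + m) := Nat.mul_le_mul_left _ (by omega)
      simp only [hp]
      rw [Nat.mul_add_one] at h2
      omega
    · intro l hl
      obtain ⟨h1, h2, h3⟩ := hGk l hl
      rw [← h2, hf _ (hrange r hr l h1).1, (hdiv r hr l).1]
      simp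
    · intro l hl
      obtain ⟨h1, h2, h3⟩ := hGk l hl
      rw [← h3, hf _ (hrange r hr l h1).2, (hdiv r hr l).2]
      simp
  calc b * (k - k / 2) = ∑ r ∈ range b, (k - k / 2) := by simp
    _ ≤ ∑ r ∈ range b, #(bad r) := sum_le_sum fun r hr => hbadcard r (mem_range.1 hr)
    _ = #((range b).sigma bad) := (card_sigma _ _).symm
    _ ≤ _ := by
      -- The offset and period of an index recover its pair, so different bad pairs account for
      -- different indices.
      refine card_le_card_of_surjOn (fun i => (⟨i % b, i / b / 2 - a⟩ : (_ : ℕ) × ℕ)) ?_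
      rintro ⟨r, l⟩ hrl
      simp only [coe_sigma, Set.mem_sigma_iff, mem_coe, mem_range, hbad, mem_filter] at hrl
      obtain ⟨hr, hl, h⟩ := hrl
      simp only [Set.mem_image, coe_filter, Set.mem_ofPred_eq]
      rcases h with h | h
      · refine ⟨p r l, ⟨(hrange r hr l hl).1, h⟩, ?_⟩
        rw [hmod r hr, (hdiv r hr l).1]
        congr 1
        omega
      · refine ⟨p r l + b, ⟨(hrange r hr l hl).2, h⟩, ?_⟩
        rw [Nat.add_mod_right, hmod r hr, (hdiv r hr l).2]
        congr 1
        omega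

/-- The point whose set of ones is `A ∪ B`. -/
def glue {n : ℕ} {S : Finset (Fin n)} (A : Finset S) (B : Finset (Fin n)) : Cube n := fun i =>
  decide (i ∈ A.map (Function.Embedding.subtype _) ∪ B)

theorem weightOn_glue {n : ℕ} {S : Finset (Fin n)} (A : Finset S) {B : Finset (Fin n)}
    (hB : B ⊆ Sᶜ) : weightOn S (glue A B) = #A := by
  rw [weightOn, ← card_map (Function.Embedding.subtype (· ∈ S))]
  congr 1
  ext i
  have : i ∈ B → i ∉ S := fun h => by simpa using hB h
  simp only [glue, mem_filter, mem_union, decide_eq_true_eq, mem_map,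
    Function.Embedding.coe_subtype, Subtype.exists, exists_and_right, exists_eq_right]
  constructor
  · rintro ⟨h1, h2 | h2⟩
    · exact h2
    · exact absurd h1 (this h2)
  · rintro ⟨h1, h2⟩
    exact ⟨h1, Or.inl ⟨h1, h2⟩⟩

theorem weightOn_univ_glue {n : ℕ} {S : Finset (Fin n)} (A : Finset S) {B : Finset (Fin n)}
    (hB : B ⊆ Sᶜ) : weightOn univ (glue A B) = #A + #B := by
  rw [weightOn, ← card_map (Function.Embedding.subtype (· ∈ S)), ← card_union_of_disjoint]
  · congr 1
    ext i
    simp [glue]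
  · rw [disjoint_left]
    intro i hi hi'
    have := hB hi'
    simp only [mem_map, Function.Embedding.coe_subtype, Subtype.exists, exists_and_right,
      exists_eq_right, mem_compl] at hi this
    exact this hi.1

theorem glue_injective {n : ℕ} {S : Finset (Fin n)} {A A' : Finset S} {B B' : Finset (Fin n)}
    (hB : B ⊆ Sᶜ) (hB' : B' ⊆ Sᶜ) (h : glue A B = glue A' B') : A = A' ∧ B = B' := by
  have key : ∀ i, i ∈ A.map (Function.Embedding.subtype _) ∪ B ↔
      i ∈ A'.map (Function.Embedding.subtype _) ∪ B' := fun i => by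
    simpa only [glue, decide_eq_decide] using congrFun h i
  simp only [mem_union, mem_map, Function.Embedding.coe_subtype, Subtype.exists,
    exists_and_right, exists_eq_right] at key
  have hb : ∀ i, i ∈ B → i ∉ S := fun i h => by simpa using hB h
  have hb' : ∀ i, i ∈ B' → i ∉ S := fun i h => by simpa using hB' h
  constructor
  · ext ⟨i, hi⟩
    have := key i
    have h1 : i ∉ B := fun h => hb i h hi
    have h2 : i ∉ B' := fun h => hb' i h hi
    simpa [hi, h1, h2] using this
  · ext i
    have := key i
    by_cases hi : i ∈ S
    · exact ⟨fun h => absurd hi (hb i h), fun h => absurd hi (hb' i h)⟩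
    · simpa [hi] using this

theorem glue_mono {n : ℕ} {S : Finset (Fin n)} {A A' : Finset S} (B : Finset (Fin n))
    (h : A ⊆ A') : glue A B ≤ glue A' B := by
  intro i
  simp only [glue]
  rw [Bool.le_iff_imp]
  simp only [decide_eq_true_eq, mem_union]
  rintro (h1 | h1)
  · exact Or.inl (map_subset_map.2 h h1)
  · exact Or.inr h1

/-- The band function is far from `k`-monotone. -/
theorem le_hammingDist_bandFunction {n k b h j₀ w : ℕ} (hb : 1 ≤ b) {S : Finset (Fin n)}
    (hS : #S = 2 * h) (hw : w = 2 * b * (k + 1)) (hwh : 2 * w ^ 2 ≤ h) (hj : j₀ = (n - 2 * h) / 2)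
    (hwj : 2 * w ^ 2 ≤ j₀) {g : Cube n → Bool} (hg : g ∈ kMonotone n k) :
    ((w + 1 : ℕ) : ℝ) * ((4 : ℝ) ^ j₀ / (4 * √j₀)) *
        ((4 : ℝ) ^ h / (4 * √h) * ((b * (k - k / 2) : ℕ) : ℝ)) ≤
      hammingDist (bandFunction S b (h + j₀ - w) w) g := by
  classical
  set f := bandFunction S b (h + j₀ - w) w with hf
  have hwpos : 1 ≤ w := by rw [hw]; nlinarith
  have hww : w ≤ w ^ 2 := Nat.le_self_pow (by norm_num) w
  -- For these sizes of `B` the band, read in the fibre over `B`, consists of levels of `S` within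
  -- `w` of the middle level `h`.
  set 𝓑 : Finset (Finset (Fin n)) := {B ∈ powerset Sᶜ | #B ∈ Icc (j₀ - w) j₀} with h𝓑
  set bad : Finset (Fin n) → Finset (Finset S) := fun B =>
    {A | #A ∈ Ico (h + j₀ - w - #B) (h + j₀ - w - #B + w) ∧ f (glue A B) ≠ g (glue A B)} with hbad
  have hcardS : Fintype.card S = 2 * h := by rw [Fintype.card_coe, hS]
  have hbadcard : ∀ B ∈ 𝓑, (4 : ℝ) ^ h / (4 * √h) * ((b * (k - k / 2) : ℕ) : ℝ) ≤ #(bad B) := by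
    intro B hB
    simp only [h𝓑, mem_filter, mem_powerset, mem_Icc] at hB
    obtain ⟨hBS, hB1, hB2⟩ := hB
    refine mul_le_card_of_forall_numbering (fun A => f (glue A B) ≠ g (glue A B))
      (Ico (h + j₀ - w - #B) (h + j₀ - w - #B + w)) _ _ ?_ ?_ ?_
    · intro i hi
      rw [mem_Ico] at hi
      omega
    · intro i hi
      rw [mem_Ico] at hi
      rw [hcardS]
      exact four_pow_le_choose_mul_sqrt (a := w) (by omega) hwh (by omega) (by omega)
    · intro σ
      have hcard : ∀ i ≤ 2 * h, #({x | (σ x : ℕ) < i} : Finset S) = i := by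
        intro i hi
        have : ({x | (σ x : ℕ) < i} : Finset S) =
            ({j : Fin (Fintype.card S) | (j : ℕ) < i} : Finset _).map σ.symm.toEmbedding := by
          ext x
          simp [mem_map_equiv]
        rw [this, card_map, Fin.card_filter_val_lt, hcardS, min_eq_right hi]
      rw [hw]
      -- Only coordinates of `S` change along this chain, so it crosses the band one level at a time
      -- while the weight on `S` runs through `k + 1` periods.
      refine le_card_ne_of_chain hb hg (fun i => glue {x | (σ x : ℕ) < i} B) (N := 2 * h) ?_ ?_ ?_
      · intro i j hij hj
        refine lt_of_le_of_ne (glue_mono B fun x hx => ?_) fun he => ?_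
        · simp only [mem_filter, mem_univ, true_and] at hx ⊢
          omega
        · have h1 := congrArg card (glue_injective hBS hBS he).1
          rw [hcard i (by omega), hcard j hj] at h1
          omega
      · rw [← hw]
        omega
      · intro i hi
        rw [← hw, mem_Ico] at hi
        have h1 := hcard i (by omega)
        simp only [hf, bandFunction, weightOn_glue _ hBS, weightOn_univ_glue _ hBS, h1,
          decide_eq_decide]
        exact ⟨fun h => h.2.2, fun h => ⟨by omega, by omega, h⟩⟩
  have h𝓑card : ((w + 1 : ℕ) : ℝ) * ((4 : ℝ) ^ j₀ / (4 * √j₀)) ≤ #𝓑 := by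
    have h1 : #𝓑 = ∑ j ∈ Icc (j₀ - w) j₀, (n - 2 * h).choose j := by
      rw [card_eq_sum_card_fiberwise (f := card) (t := Icc (j₀ - w) j₀)
        (fun B hB => by simpa [h𝓑] using (mem_filter.1 hB).2)]
      refine sum_congr rfl fun j hj => ?_
      have : n - 2 * h = #Sᶜ := by rw [card_compl, Fintype.card_fin, hS]
      rw [this, ← card_powersetCard]
      congr 1
      ext B
      simp only [h𝓑, mem_filter, mem_powerset, mem_powersetCard]
      exact ⟨fun h => ⟨h.1.1, h.2⟩, fun h => ⟨⟨h.1, h.2 ▸ hj⟩, h.2⟩⟩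
    rw [h1]
    have h2 : w + 1 = #(Icc (j₀ - w) j₀) := by rw [Nat.card_Icc]; omega
    rw [h2, ← nsmul_eq_mul]
    push_cast
    refine card_nsmul_le_sum _ _ _ fun j hj' => ?_
    rw [mem_Icc] at hj'
    -- `n - 2 * h` may be odd; the estimate is made for `2 * j₀` and carried over by monotonicity of
    -- `choose`.
    refine (four_pow_le_choose_mul_sqrt (a := w) (by omega) hwj (i := j) (by omega)
      (by omega)).trans ?_
    exact_mod_cast Nat.choose_le_choose j (by omega)
  have hsum : (∑ B ∈ 𝓑, #(bad B)) ≤ hammingDist f g := by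
    rw [← card_sigma, hammingDist]
    refine card_le_card_of_injOn (fun p => glue p.2 p.1) ?_ ?_
    · rintro ⟨B, A⟩ hp
      simp only [coe_sigma, Set.mem_sigma_iff, mem_coe, hbad, mem_filter, mem_univ,
        true_and] at hp
      simpa using hp.2.2
    · rintro ⟨B, A⟩ hp ⟨B', A'⟩ hp' he
      simp only [coe_sigma, Set.mem_sigma_iff, mem_coe, h𝓑, mem_filter, mem_powerset] at hp hp'
      obtain ⟨rfl, rfl⟩ := glue_injective hp.1.1 hp'.1.1 he
      rfl
  calc _ ≤ (#𝓑 : ℝ) * ((4 : ℝ) ^ h / (4 * √h) * ((b * (k - k / 2) : ℕ) : ℝ)) :=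
        mul_le_mul_of_nonneg_right h𝓑card (by positivity)
    _ = ∑ B ∈ 𝓑, ((4 : ℝ) ^ h / (4 * √h) * ((b * (k - k / 2) : ℕ) : ℝ)) := by simp
    _ ≤ ∑ B ∈ 𝓑, (#(bad B) : ℝ) := sum_le_sum hbadcard
    _ ≤ _ := by exact_mod_cast hsum

/-! ### Counting queries and choosing parameters -/

/-- Few queries contain violations of the band functions of few sets `S` only. -/
theorem two_pow_le_of_violating {n k b t₀ w s t q : ℕ} (hk : 2 ≤ k) (hb : 1 ≤ b)
    (ht : t = (2 * (k / 2) - 1) * b) (hwt : w ≤ 8 * t) (hts : t ≤ s) (hs0 : 1 ≤ s)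
    (hsn : s * 2 ^ 10 ≤ n) {Q : Finset (Cube n)} (hQ : #Q ≤ q)
    {v : Finset (Finset (Fin n))} (hv : v ⊆ powersetCard s univ)
    (hcard : 2 / 3 * (#(powersetCard s (univ : Finset (Fin n))) : ℝ) ≤ #v)
    (hviol : ∀ S ∈ v, ∃ x : Fin (k + 1) → Cube n,
      IsViolation k (bandFunction S b t₀ w) x ∧ ∀ j, x j ∈ Q) :
    2 ^ t ≤ 2 * q := by
  classical
  have hsle : s ≤ n := by omega
  set C := n.choose s with hC
  have hCpos : 0 < C := Nat.choose_pos hsle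
  -- Each violated `S` is charged to a pair of queries with a short increment that meets `S` in at
  -- least `t` coordinates.
  have hsub : v ⊆ {p ∈ Q ×ˢ Q | #(increment p.1 p.2) ≤ w}.biUnion fun p =>
      {S ∈ powersetCard s (univ : Finset (Fin n)) | t ≤ #(increment p.1 p.2 ∩ S)} := by
    intro S hS
    obtain ⟨x, hx, hxQ⟩ := hviol S hS
    obtain ⟨a, c, h1, h2⟩ := hx.exists_increment hk hb
    rw [mem_biUnion]
    exact ⟨(x a, x c), mem_filter.2 ⟨mem_product.2 ⟨hxQ a, hxQ c⟩, h1⟩,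
      mem_filter.2 ⟨hv hS, ht ▸ h2⟩⟩
  have hbound : ∀ p ∈ ({p ∈ Q ×ˢ Q | #(increment p.1 p.2) ≤ w} : Finset (Cube n × Cube n)),
      #{S ∈ powersetCard s (univ : Finset (Fin n)) | t ≤ #(increment p.1 p.2 ∩ S)} ≤
        C / 4 ^ t := by
    intro p hp
    have h1 := card_filter_le_card_inter_mul_pow_le (increment p.1 p.2) (s := s) (t := t)
      (by rwa [Fintype.card_fin]) hts (mem_filter.1 hp).2
    rw [Fintype.card_fin, ← hC] at h1
    rw [Nat.le_div_iff_mul_le (by positivity)]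
    set N := #{S ∈ powersetCard s (univ : Finset (Fin n)) | t ≤ #(increment p.1 p.2 ∩ S)}
    have h2 : (s * 2 ^ 10) ^ t ≤ n ^ t := Nat.pow_le_pow_left hsn t
    have h3 : 2 ^ w ≤ 2 ^ (8 * t) := Nat.pow_le_pow_right (by norm_num) hwt
    refine Nat.le_of_mul_le_mul_left (c := 2 ^ (8 * t) * s ^ t) ?_ (by positivity)
    calc 2 ^ (8 * t) * s ^ t * (N * 4 ^ t) = N * (s * 2 ^ 10) ^ t := by
          rw [mul_pow, ← pow_mul, show (4 : ℕ) = 2 ^ 2 by norm_num, ← pow_mul,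
            show 10 * t = 8 * t + 2 * t by ring, pow_add]
          ring
      _ ≤ N * n ^ t := Nat.mul_le_mul_left _ h2
      _ ≤ 2 ^ w * (s ^ t * C) := h1
      _ ≤ 2 ^ (8 * t) * (s ^ t * C) := Nat.mul_le_mul_right _ h3
      _ = _ := by ring
  have hvcard : #v * 4 ^ t ≤ q ^ 2 * C := by
    have h1 : #v ≤ q ^ 2 * (C / 4 ^ t) := by
      refine (card_le_card hsub).trans ((card_biUnion_le_card_mul _ _ _ hbound).trans ?_)
      refine Nat.mul_le_mul_right _ ((card_filter_le _ _).trans ?_)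
      rw [card_product, sq]
      exact Nat.mul_le_mul hQ hQ
    calc #v * 4 ^ t ≤ q ^ 2 * (C / 4 ^ t) * 4 ^ t := Nat.mul_le_mul_right _ h1
      _ = q ^ 2 * (C / 4 ^ t * 4 ^ t) := by ring
      _ ≤ q ^ 2 * C := Nat.mul_le_mul_left _ (Nat.div_mul_le_self _ _)
  rw [card_powersetCard, card_univ, Fintype.card_fin, ← hC] at hcard
  have h1 : (#v : ℝ) * 4 ^ t ≤ q ^ 2 * C := by exact_mod_cast hvcard
  have hCpos' : (0 : ℝ) < C := by exact_mod_cast hCpos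
  -- The count gives `(2/3) 4^t ≤ q^2`; the constant is relaxed to make the right side a square.
  have h2 : (4 : ℝ) ^ t ≤ (2 * q) ^ 2 := by
    refine le_of_mul_le_mul_right ?_ hCpos'
    have h3 : 2 / 3 * (C : ℝ) * 4 ^ t ≤ #v * 4 ^ t :=
      mul_le_mul_of_nonneg_right hcard (by positivity)
    have h4 : (0 : ℝ) ≤ q ^ 2 * C := by positivity
    linarith
  have h3 : (2 ^ t) ^ 2 ≤ (2 * q) ^ 2 := by
    rw [← pow_mul, mul_comm t 2, pow_mul]
    exact_mod_cast h2
  exact (Nat.pow_le_pow_iff_left (by norm_num)).1 h3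

/-- With a band of width of order `√n` the band function has constant distance from
`k`-monotone. -/
theorem le_distToProperty_bandFunction {n k b h j₀ w : ℕ} (hb : 1 ≤ b) {S : Finset (Fin n)}
    (hS : #S = 2 * h) (hn : 2 * h ≤ n) (hw : w = 2 * b * (k + 1)) (hwh : 2 * w ^ 2 ≤ h)
    (hj : j₀ = (n - 2 * h) / 2) (hwj : 2 * w ^ 2 ≤ j₀) (hbk : n ≤ (b * k) ^ 2 * 2 ^ 22) :
    1 / 2 ^ 27 ≤ distToProperty (bandFunction S b (h + j₀ - w) w) (kMonotone n k) := by
  rw [le_distToProperty_iff _ ⟨_, const_false_mem_kMonotone n k⟩]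
  intro g hg
  rw [funDist, le_div_iff₀ (by positivity)]
  refine le_trans ?_ (le_hammingDist_bandFunction hb hS hw hwh hj hwj hg)
  have hwpos : 1 ≤ w := by rw [hw]; nlinarith
  have hww : w ≤ w ^ 2 := Nat.le_self_pow (by norm_num) w
  have hh0 : (0 : ℝ) < h := by exact_mod_cast (by omega : 0 < h)
  have hj0 : (0 : ℝ) < j₀ := by exact_mod_cast (by omega : 0 < j₀)
  have hn0 : (0 : ℝ) < n := by exact_mod_cast (by omega : 0 < n)
  have hhn : (h : ℝ) ≤ n := by exact_mod_cast (by omega : h ≤ n)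
  have hjn : (j₀ : ℝ) ≤ n := by exact_mod_cast (by omega : j₀ ≤ n)
  have e1 : √j₀ * √h ≤ n := by
    rw [← Real.sqrt_mul hj0.le]
    exact Real.sqrt_le_iff.2 ⟨hn0.le, by nlinarith⟩
  -- The factor 2 covers odd `n`, where `2 * j₀ + 2 * h = n - 1`.
  have e2 : (2 : ℝ) ^ n / 2 ≤ 4 ^ j₀ * 4 ^ h := by
    rw [← pow_add, div_le_iff₀ (by norm_num), show (4 : ℝ) = 2 ^ 2 by norm_num, ← pow_mul,
      ← pow_succ]
    exact pow_le_pow_right₀ (by norm_num) (by omega)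
  have e3 : (n : ℝ) / 2 ^ 22 ≤ ((w + 1 : ℕ) : ℝ) * ((b * (k - k / 2) : ℕ) : ℝ) := by
    rw [div_le_iff₀ (by positivity)]
    have h1 : (b * k) ^ 2 ≤ (w + 1) * (b * (k - k / 2)) := by
      have h2 : 2 * (b * k) ≤ w + 1 := by rw [hw]; nlinarith
      have h3 : b * k ≤ 2 * (b * (k - k / 2)) := by
        rw [mul_left_comm]
        exact Nat.mul_le_mul_left _ (by omega)
      have h4 := Nat.mul_le_mul h2 h3
      linarith
    exact_mod_cast hbk.trans (Nat.mul_le_mul_right _ h1)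
  have e4 : (0 : ℝ) < √j₀ * √h := by positivity
  calc (1 : ℝ) / 2 ^ 27 * 2 ^ n = (n / 2 ^ 22) * (2 ^ n / 2) / (16 * n) := by
        field_simp
        norm_num
    _ ≤ (n / 2 ^ 22) * (2 ^ n / 2) / (16 * (√j₀ * √h)) := by gcongr
    _ ≤ (((w + 1 : ℕ) : ℝ) * ((b * (k - k / 2) : ℕ) : ℝ)) * (4 ^ j₀ * 4 ^ h) /
          (16 * (√j₀ * √h)) := by gcongr
    _ = _ := by
        field_simp
        norm_num

/-- For `y = n^(1/4)` the hypotheses say `12288 ≤ y` and `y^2 ≤ 6144 t`, hence `y ≤ t / 2 ≤ t log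
2`. -/
theorem exp_rpow_le_two_pow {n t : ℕ} (hn : 12288 ^ 4 ≤ n) (ht : n ≤ (6144 * t) ^ 2) :
    Real.exp ((n : ℝ) ^ ((1 : ℝ) / 4)) ≤ 2 ^ t := by
  set y : ℝ := (n : ℝ) ^ ((1 : ℝ) / 4) with hy
  have hy0 : 0 ≤ y := by positivity
  have hy4 : y ^ 4 = n := by
    rw [hy, ← Real.rpow_natCast, ← Real.rpow_mul (by positivity)]
    norm_num
  have h1 : (12288 : ℝ) ≤ y := by
    refine le_of_pow_le_pow_left₀ (n := 4) (by norm_num) hy0 ?_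
    rw [hy4]
    exact_mod_cast hn
  have h2 : y ^ 2 ≤ 6144 * t := by
    refine le_of_pow_le_pow_left₀ (n := 2) (by norm_num) (by positivity) ?_
    rw [← pow_mul, hy4]
    exact_mod_cast ht
  have h3 : y ≤ t * Real.log 2 := by
    have := Real.log_two_gt_d9
    have h4 : (t : ℝ) * (1 / 2) ≤ t * Real.log 2 :=
      mul_le_mul_of_nonneg_left (by linarith) (by positivity)
    nlinarith
  calc Real.exp y ≤ Real.exp (t * Real.log 2) := Real.exp_le_exp.2 h3
    _ = 2 ^ t := by rw [Real.exp_nat_mul, Real.exp_log (by norm_num)]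

/-- The quantitative lower bound for a single dimension. -/
theorem exp_le_of_isOneSidedTester {n k : ℕ} (hk : 2 ≤ k) (hn : 12288 ^ 4 ≤ n)
    (hkn : 512 * k ≤ n.sqrt) {ε : ℝ} (hε : ε ≤ 1 / 2 ^ 27) {q : ℕ} {Ω : Type*}
    [MeasurableSpace Ω] {μ : MeasureTheory.Measure Ω} [MeasureTheory.IsProbabilityMeasure μ]
    {T : NonAdaptiveAlgorithm n q Ω} (hT : T.IsOneSidedTester μ (kMonotone n k) ε) :
    1 / 2 * Real.exp ((n : ℝ) ^ ((1 : ℝ) / 4)) ≤ q := by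
  obtain ⟨r, hr⟩ : ∃ r, r = n.sqrt := ⟨_, rfl⟩
  -- This puts `b * k` between `r / 1024` and `r / 512`: large enough for constant distance, small
  -- enough for `2 * w ^ 2 ≤ h`.
  obtain ⟨b, hbdef⟩ : ∃ b, b = r / (512 * k) := ⟨_, rfl⟩
  obtain ⟨h, hh⟩ : ∃ h, h = n / 2 ^ 11 := ⟨_, rfl⟩
  obtain ⟨j₀, hj⟩ : ∃ j₀, j₀ = (n - 2 * h) / 2 := ⟨_, rfl⟩
  obtain ⟨w, hw⟩ : ∃ w, w = 2 * b * (k + 1) := ⟨_, rfl⟩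
  obtain ⟨t, ht⟩ : ∃ t, t = (2 * (k / 2) - 1) * b := ⟨_, rfl⟩
  rw [← hr] at hkn
  have hr1 : r ^ 2 ≤ n := hr ▸ Nat.sqrt_le' n
  have hr2 : n < (r + 1) ^ 2 := hr ▸ Nat.lt_succ_sqrt' n
  have hr0 : 1 ≤ r := by omega
  have hnr : n ≤ (2 * r) ^ 2 := by nlinarith
  have hb : 1 ≤ b := by
    rw [hbdef, Nat.le_div_iff_mul_le (by omega)]
    omega
  have hb1 : 512 * (b * k) ≤ r := by
    have := Nat.div_mul_le_self r (512 * k)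
    rw [← hbdef] at this
    linarith
  have hb2 : r ≤ 1024 * (b * k) := by
    have := Nat.lt_mul_div_succ r (by omega : 0 < 512 * k)
    rw [← hbdef] at this
    nlinarith
  have hw1 : w ≤ 3 * (b * k) := by rw [hw]; nlinarith
  have hw2 : 512 * w ≤ 3 * r := by omega
  have hwh : 2 * w ^ 2 ≤ h := by
    have h1 : (512 * w) ^ 2 ≤ 9 * n :=
      (Nat.pow_le_pow_left hw2 2).trans (by rw [mul_pow]; omega)
    rw [mul_pow] at h1
    omega
  have hwj : 2 * w ^ 2 ≤ j₀ := by omega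
  have hbk : n ≤ (b * k) ^ 2 * 2 ^ 22 := by
    calc n ≤ (2 * r) ^ 2 := hnr
      _ ≤ (2 * (1024 * (b * k))) ^ 2 := Nat.pow_le_pow_left (by omega) 2
      _ = _ := by ring
  have hwpos : 1 ≤ w := by rw [hw]; nlinarith
  have hww : w ≤ w ^ 2 := Nat.le_self_pow (by norm_num) w
  have htw : t ≤ w := by
    rw [ht, hw, show 2 * b * (k + 1) = (2 * (k + 1)) * b by ring]
    exact Nat.mul_le_mul_right _ (by omega)
  -- The inequality `2(k + 1) ≤ 8(2⌊k/2⌋ - 1)` is tight at `k = 3`, and so is the factor 3 in `htk`.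
  have hwt : w ≤ 8 * t := by
    rw [ht, hw, show 2 * b * (k + 1) = (2 * (k + 1)) * b by ring, ← mul_assoc]
    exact Nat.mul_le_mul_right _ (by omega)
  have htk : b * k ≤ 3 * t := by
    rw [ht, mul_comm b k, ← mul_assoc]
    exact Nat.mul_le_mul_right _ (by omega)
  have htn : n ≤ (6144 * t) ^ 2 := hnr.trans (Nat.pow_le_pow_left (by omega) 2)
  obtain ⟨Q, hQ, v, hv, hcard, hviol⟩ := exists_queries_violating hT
    (powersetCard (2 * h) (univ : Finset (Fin n))) (fun S => bandFunction S b (h + j₀ - w) w)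
    fun S hS => hε.trans (le_distToProperty_bandFunction hb (mem_powersetCard.1 hS).2 (by omega)
      hw hwh hj hwj hbk)
  have h1 := two_pow_le_of_violating hk hb ht hwt (by omega) (by omega) (by omega) hQ hv hcard hviol
  have h2 : (2 : ℝ) ^ t ≤ 2 * q := by exact_mod_cast h1
  have h3 := exp_rpow_le_two_pow hn htn
  linarith

end KMonotoneTesting

theorem mainTheorem6 :
    ∃ ε₀ : ℝ, 0 < ε₀ ∧ ε₀ ≤ 1 ∧ ∃ c : ℝ, 0 < c ∧
      ∀ k : ℕ → ℕ, (∀ n, 2 ≤ k n) →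
        Asymptotics.IsLittleO Filter.atTop (fun n : ℕ => (k n : ℝ)) (fun n : ℕ => √(n : ℝ)) →
        ∃ n₀ : ℕ, ∀ n : ℕ, n₀ ≤ n → ∀ ε : ℝ, 0 < ε → ε ≤ ε₀ →
          ∀ (q : ℕ) (Ω : Type*) [MeasurableSpace Ω] (μ : MeasureTheory.Measure Ω)
            [MeasureTheory.IsProbabilityMeasure μ]
            (T : KMonotoneTesting.NonAdaptiveAlgorithm n q Ω),
            T.IsOneSidedTester μ (KMonotoneTesting.kMonotone n (k n)) ε →
              c * Real.exp ((n : ℝ) ^ ((1 : ℝ) / 4)) ≤ (q : ℝ) := by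
  refine ⟨1 / 2 ^ 27, by norm_num, by norm_num, 1 / 2, by norm_num, fun k hk ho => ?_⟩
  -- The growth condition on `k` enters only through `512 * k n ≤ √n` for large `n`, which makes `b
  -- ≥ 1`.
  obtain ⟨n₁, hn₁⟩ := Filter.eventually_atTop.1
    (ho.bound (by norm_num : (0 : ℝ) < 1 / 512))
  refine ⟨max n₁ (12288 ^ 4), fun n hn ε _ hε q Ω _ μ _ T hT => ?_⟩
  refine KMonotoneTesting.exp_le_of_isOneSidedTester (hk n) (le_of_max_le_right hn) ?_ hε hT
  have h1 := hn₁ n (le_of_max_le_left hn)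
  rw [Real.norm_of_nonneg (by positivity), Real.norm_of_nonneg (by positivity)] at h1
  rw [Nat.le_sqrt']
  have h2 : (512 * k n : ℝ) ≤ √n := by linarith
  have h3 := (Real.le_sqrt (by positivity) (by positivity)).1 h2
  exact_mod_cast h3
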